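/- Let $\mathbb{C}_+$ be the open upper half-plane and let $H^\infty_1$ be the set of holomorphic functions $b$ on $\mathbb{C}_+$ with $\sup_{\mathbb{C}_+}|b|\le 1$. For $b\in H^\infty_1$ let $\mathcal{H}(b)$ be the de Branges--Rovnyak space, i.e. the reproducing kernel Hilbert space of functions on $\mathbb{C}_+$ with kernel $$k_\lambda^b(z)=\frac{i}{2\pi}\,\frac{1-\overline{b(\lambda)}\,b(z)}{z-\overline{\lambda}},\qquad \lambda,z\in\mathbb{C}_+,$$ and let $\kappa_\lambda^b=k_\lambda^b/\|k_\lambda^b\|_b$ be the normalized kernels. A sequence $(x_n)_{n\ge p}$ in a Hilbert space is an asymptotically orthonormal basic sequence (AOB) if for every $N\ge p$ there are constants $c_N,C_N>0$ with $$c_N\sum_{n\ge N}|a_n|^2\le\Big\|\sum_{n\ge N}a_nx_n\Big\|^2\le C_N\sum_{n\ge N}|a_n|^2$$ for all finitely supported complex sequences $(a_n)$, and $c_N\to1$, $C_N\to 1$ as $N\to\infty$; it is complete if its closed linear span is the whole space. Let $b_1=b_2b$ with $b_2,b\in H^\infty_1$, where $b_2$ is not a constant of modulus one, and let $(\lambda_n)_{n\ge1}\subset\mathbb{C}_+$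 satisfy $$\sum_{n\ge1}\left|\frac{\|k_{\lambda_n}^{b_1}\|_{b_1}^2}{\|k_{\lambda_n}^{b_2}\|_{b_2}^2}-1\right|=\sum_{n\ge1}\left|\frac{1-|b_1(\lambda_n)|^2}{1-|b_2(\lambda_n)|^2}-1\right|<\infty.$$ (1) If $(\kappa_{\lambda_n}^{b_1})_{n\ge1}$ is a complete AOB in $\mathcal{H}(b_1)$, then there is an integer $p\ge1$ such that $(\kappa_{\lambda_n}^{b_2})_{n\ge p}$ is a complete AOB in $\mathcal{H}(b_2)$. (2) Conversely, if $(\kappa_{\lambda_n}^{b_2})_{n\ge1}$ is an AOB in $\mathcal{H}(b_2)$, then $(\kappa_{\lambda_n}^{b_1})_{n\ge1}$ is an AOB in $\mathcal{H}(b_1)$. -/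

import Mathlib

open scoped ComplexConjugate

namespace HbSpace

open Metric Complex
open scoped UpperHalfPlane Manifold

lemma diff_cauchy {ι : Type*} (s : Finset ι) (w c : ι → ℂ) (hw : ∀ j, ‖w j‖ < 1) {z : ℂ}
    (hz : z ∈ closedBall (0 : ℂ) 1) :
    DifferentiableAt ℂ (fun z => ∑ j ∈ s, c j / (1 - conj (w j) * z)) z := by
  have h (j : ι) : 1 - conj (w j) * z ≠ 0 := by
    intro h0
    have h1 : conj (w j) * z = 1 := (sub_eq_zero.mp h0).symm
    have h2 : ‖w j‖ * ‖z‖ = 1 := by simpa using congrArg norm h1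
    have h3 : ‖z‖ ≤ 1 := by simpa using hz
    nlinarith [hw j, norm_nonneg (w j), norm_nonneg z]
  refine DifferentiableAt.fun_sum fun j _ => ?_
  exact (differentiableAt_const _).div (by fun_prop) (h j)

lemma circleIntegrable_of_cont {f : ℂ → ℂ} (hf : ∀ z ∈ closedBall (0 : ℂ) 1, ContinuousAt f z) :
    CircleIntegrable f 0 1 :=
  ContinuousOn.circleIntegrable zero_le_one
    fun z hz => (hf z (sphere_subset_closedBall hz)).continuousWithinAt

lemma circleAverage_cauchy {ι : Type*} (s : Finset ι) (w c : ι → ℂ) (hw : ∀ j, ‖w j‖ < 1)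
    {h : ℂ → ℂ} (hh : ∀ z ∈ closedBall (0 : ℂ) 1, DifferentiableAt ℂ h z) :
    Real.circleAverage (fun z => h z * conj (∑ j ∈ s, c j / (1 - conj (w j) * z))) 0 1
      = ∑ j ∈ s, conj (c j) * h (w j) := by
  have hne (j : ι) : ∀ z ∈ sphere (0 : ℂ) 1, z - w j ≠ 0 := by
    intro z hz h0
    have h1 : ‖z‖ = 1 := by simpa using hz
    rw [sub_eq_zero.mp h0] at h1
    linarith [hw j]
  have e1 : Set.EqOn (fun z => h z * conj (∑ j ∈ s, c j / (1 - conj (w j) * z)))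
      (fun z => ∑ j ∈ s, conj (c j) • (((z - 0) / (z - w j)) • h z)) (sphere (0 : ℂ) |1|) := by
    intro z hz
    rw [abs_one] at hz
    have h1 : ‖z‖ = 1 := by simpa using hz
    have hz0 : z ≠ 0 := by rintro rfl; simp at h1
    have hc : conj z = z⁻¹ := by
      rw [Complex.inv_def, Complex.normSq_eq_norm_sq, h1]; simp
    simp only [map_sum, Finset.mul_sum, smul_eq_mul, sub_zero]
    refine Finset.sum_congr rfl fun j _ => ?_
    have := hne j z hz
    simp only [map_div₀, map_sub, map_one, map_mul, Complex.conj_conj, hc]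
    have h2 : 1 - w j * z⁻¹ = (z - w j) / z := by field_simp
    rw [h2]
    field_simp
  rw [Real.circleAverage_congr_sphere e1, Real.circleAverage_fun_sum]
  · refine Finset.sum_congr rfl fun j _ => ?_
    rw [Real.circleAverage_fun_smul, DiffContOnCl.circleAverage_smul_div]
    · rfl
    · refine DifferentiableOn.diffContOnCl fun z hz => ?_
      rw [abs_one, closure_ball _ one_ne_zero] at hz
      exact (hh z hz).differentiableWithinAt
    · simpa using hw j
  · intro j _
    refine ContinuousOn.circleIntegrable zero_le_one fun z hz => ContinuousAt.continuousWithinAt ?_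
    have h1 := (hh z (sphere_subset_closedBall hz)).continuousAt
    have h2 := hne j z hz
    have h3 : ContinuousAt (fun z => (z - 0) / (z - w j)) z :=
      ContinuousAt.div (by fun_prop) (by fun_prop) h2
    exact (h3.smul h1).const_smul (conj (c j))

lemma disc_nonneg_aux {ι : Type*} (s : Finset ι) (w c : ι → ℂ) (hw : ∀ j, ‖w j‖ < 1) {g : ℂ → ℂ}
    (hg : ∀ z ∈ closedBall (0 : ℂ) 1, DifferentiableAt ℂ g z)
    (hb : ∀ z ∈ closedBall (0 : ℂ) 1, ‖g z‖ ≤ 1) :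
    0 ≤ (∑ k ∈ s, ∑ j ∈ s, conj (c k) * c j *
      ((1 - conj (g (w j)) * g (w k)) / (1 - conj (w j) * w k))).re := by
  set F : ℂ → ℂ := fun z => ∑ j ∈ s, c j / (1 - conj (w j) * z) with hF
  set G : ℂ → ℂ := fun z => ∑ j ∈ s, (c j * conj (g (w j))) / (1 - conj (w j) * z) with hG
  have dF : ∀ z ∈ closedBall (0 : ℂ) 1, DifferentiableAt ℂ F z := fun z hz => diff_cauchy s w c hw hz
  have dG : ∀ z ∈ closedBall (0 : ℂ) 1, DifferentiableAt ℂ G z := fun z hz =>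
    diff_cauchy s w _ hw hz
  have a1 : Real.circleAverage (fun z => F z * conj (F z)) 0 1 = ∑ k ∈ s, conj (c k) * F (w k) :=
    circleAverage_cauchy s w c hw dF
  have a2 : Real.circleAverage (fun z => G z * conj (G z)) 0 1
      = ∑ k ∈ s, conj (c k * conj (g (w k))) * G (w k) :=
    circleAverage_cauchy s w _ hw dG
  have a3 : Real.circleAverage (fun z => (g z * G z) * conj (F z)) 0 1
      = ∑ k ∈ s, conj (c k) * (g (w k) * G (w k)) :=
    circleAverage_cauchy s w c hw (h := fun z => g z * G z) fun z hz => (hg z hz).mul (dG z hz)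
  have i1 : CircleIntegrable (fun z => F z * conj (F z)) 0 1 := circleIntegrable_of_cont
    fun z hz => (dF z hz).continuousAt.mul
      (Complex.continuous_conj.continuousAt.comp (dF z hz).continuousAt)
  have i2 : CircleIntegrable (fun z => G z * conj (G z)) 0 1 := circleIntegrable_of_cont
    fun z hz => (dG z hz).continuousAt.mul
      (Complex.continuous_conj.continuousAt.comp (dG z hz).continuousAt)
  have i3 : CircleIntegrable (fun z => (g z * G z) * conj (F z)) 0 1 := circleIntegrable_of_cont
    fun z hz => ((hg z hz).continuousAt.mul (dG z hz).continuousAt).mul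
      (Complex.continuous_conj.continuousAt.comp (dF z hz).continuousAt)
  have e : (∑ k ∈ s, ∑ j ∈ s, conj (c k) * c j *
      ((1 - conj (g (w j)) * g (w k)) / (1 - conj (w j) * w k)))
      = Real.circleAverage (fun z => (F z * conj (F z) + G z * conj (G z))
        - ((g z * G z) * conj (F z) + (g z * G z) * conj (F z))) 0 1 := by
    refine Eq.trans ?_ (Real.circleAverage_sub (i1.add i2) (i3.add i3)).symm
    rw [Real.circleAverage_add i1 i2, Real.circleAverage_add i3 i3, a1, a2, a3]
    simp only [hF, hG, Finset.mul_sum, ← Finset.sum_add_distrib, ← Finset.sum_sub_distrib]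
    refine Finset.sum_congr rfl fun k _ => Finset.sum_congr rfl fun j _ => ?_
    simp only [map_mul, Complex.conj_conj]
    ring
  rw [e]
  have hI := (i1.add i2).sub (i3.add i3)
  have := Complex.reCLM.circleAverage_comp_comm hI
  have h4 : (Real.circleAverage (fun z => (F z * conj (F z) + G z * conj (G z))
        - ((g z * G z) * conj (F z) + (g z * G z) * conj (F z))) 0 1).re
      = Real.circleAverage (fun z => ((F z * conj (F z) + G z * conj (G z))
        - ((g z * G z) * conj (F z) + (g z * G z) * conj (F z))).re) 0 1 := this.symm
  rw [h4]
  refine Real.circleAverage_nonneg_of_nonneg fun z hz => ?_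
  rw [abs_one] at hz
  have hgz := hb z (sphere_subset_closedBall hz)
  have h5 : (g z * G z * conj (F z)).re ≤ ‖G z‖ * ‖F z‖ := by
    refine (Complex.re_le_norm _).trans ?_
    simp only [norm_mul, RCLike.norm_conj]
    nlinarith [norm_nonneg (G z), norm_nonneg (F z), mul_nonneg (norm_nonneg (G z)) (norm_nonneg (F z))]
  have h6 (u : ℂ) : (u * conj u).re = ‖u‖ ^ 2 := by
    rw [Complex.mul_conj, Complex.ofReal_re, Complex.normSq_eq_norm_sq]
  simp only [Complex.sub_re, Complex.add_re, h6]
  nlinarith [sq_nonneg (‖F z‖ - ‖G z‖)]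

lemma disc_nonneg {ι : Type*} (s : Finset ι) (w c : ι → ℂ) (hw : ∀ j, ‖w j‖ < 1) {g : ℂ → ℂ}
    (hg : DifferentiableOn ℂ g (ball (0 : ℂ) 1)) (hb : ∀ z ∈ ball (0 : ℂ) 1, ‖g z‖ ≤ 1) :
    0 ≤ (∑ k ∈ s, ∑ j ∈ s, conj (c k) * c j *
      ((1 - conj (g (w j)) * g (w k)) / (1 - conj (w j) * w k))).re := by
  have hg' : ∀ z ∈ ball (0 : ℂ) 1, DifferentiableAt ℂ g z := fun z hz =>
    (hg z hz).differentiableAt (isOpen_ball.mem_nhds hz)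
  have hcont (j : ι) : Filter.Tendsto (fun r : ℝ => g (r * w j)) (nhdsWithin 1 (Set.Iio 1))
      (nhds (g (w j))) := by
    have h1 : ContinuousAt g (((1 : ℝ) : ℂ) * w j) := by
      simpa using (hg' (w j) (by simpa using hw j)).continuousAt
    have h2 : ContinuousAt (fun r : ℝ => (r : ℂ) * w j) 1 := by fun_prop
    have h3 : ContinuousAt (fun r : ℝ => g (r * w j)) 1 :=
      ContinuousAt.comp (f := fun r : ℝ => (r : ℂ) * w j) h1 h2
    have h4 := h3.tendsto
    simp only [Complex.ofReal_one, one_mul] at h4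
    exact h4.mono_left nhdsWithin_le_nhds
  have hlim : Filter.Tendsto (fun r : ℝ => (∑ k ∈ s, ∑ j ∈ s, conj (c k) * c j *
      ((1 - conj (g (r * w j)) * g (r * w k)) / (1 - conj (w j) * w k))).re)
      (nhdsWithin 1 (Set.Iio 1)) (nhds (∑ k ∈ s, ∑ j ∈ s, conj (c k) * c j *
      ((1 - conj (g (w j)) * g (w k)) / (1 - conj (w j) * w k))).re) := by
    refine (Complex.continuous_re.tendsto _).comp ?_
    refine tendsto_finsetSum _ fun k _ => tendsto_finsetSum _ fun j _ => ?_
    refine Filter.Tendsto.const_mul _ (Filter.Tendsto.div_const ?_ _)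
    exact tendsto_const_nhds.sub
      (((Complex.continuous_conj.tendsto _).comp (hcont j)).mul (hcont k))
  refine ge_of_tendsto hlim ?_
  filter_upwards [Ioo_mem_nhdsLT (show (0 : ℝ) < 1 by norm_num)] with r hr
  have hmem : ∀ z ∈ closedBall (0 : ℂ) 1, (r : ℂ) * z ∈ ball (0 : ℂ) 1 := by
    intro z hz
    have : ‖z‖ ≤ 1 := by simpa using hz
    simp only [mem_ball, dist_zero_right, norm_mul, Complex.norm_real, Real.norm_eq_abs,
      abs_of_pos hr.1]
    nlinarith [hr.1, hr.2]
  exact disc_nonneg_aux s w c hw (g := fun z => g (r * z))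
    (fun z hz => (hg' _ (hmem z hz)).comp z (by fun_prop)) (fun z hz => hb _ (hmem z hz))

/-- The closed unit ball of `H^∞` of the upper half-plane: holomorphic functions on `ℍ` that are
bounded by `1` in modulus. -/
structure HInfBall where
  toFun : ℍ → ℂ
  holo : MDifferentiable 𝓘(ℂ) 𝓘(ℂ) toFun
  bound : ∀ z, ‖toFun z‖ ≤ 1

instance : CoeFun HInfBall fun _ => ℍ → ℂ := ⟨HInfBall.toFun⟩

/-- `k_λ^b(z) = (i / 2π) (1 - conj (b λ) b z) / (z - conj λ)`. -/
noncomputable def kernelValue (b : HInfBall) (l z : ℍ) : ℂ :=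
  I / (2 * Real.pi) * ((1 - conj (b l) * b z) / ((z : ℂ) - conj (l : ℂ)))

/-- The kernel of `𝓗(b)`, in the operator-valued form that Mathlib's reproducing kernel Hilbert
spaces use: the entry at `(z, λ)` is multiplication by `k_λ^b(z)`. -/
noncomputable def kernelMatrix (b : HInfBall) : Matrix ℍ ℍ (ℂ →L[ℂ] ℂ) :=
  Matrix.of fun z l => kernelValue b l z • ContinuousLinearMap.id ℂ ℂ

lemma sub_conj_ne_zero (z l : ℍ) : (z : ℂ) - conj (l : ℂ) ≠ 0 := by
  intro h
  have h1 := congrArg Complex.im h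
  simp only [Complex.sub_im, Complex.conj_im, Complex.zero_im, UpperHalfPlane.coe_im] at h1
  linarith [z.im_pos, l.im_pos]

lemma add_I_ne_zero (z : ℍ) : (z : ℂ) + I ≠ 0 := by
  intro h
  have h1 := congrArg Complex.im h
  simp only [Complex.add_im, Complex.I_im, Complex.zero_im, UpperHalfPlane.coe_im] at h1
  linarith [z.im_pos]

lemma conj_kernelValue (b : HInfBall) (l z : ℍ) : conj (kernelValue b l z) = kernelValue b z l := by
  have h1 := sub_conj_ne_zero z l
  have h2 := sub_conj_ne_zero l z
  have h3 : conj (z : ℂ) - l ≠ 0 := by rw [← neg_sub]; exact neg_ne_zero.mpr h2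
  simp only [kernelValue, map_mul, map_div₀, map_sub, map_one, Complex.conj_conj, Complex.conj_I,
    Complex.conj_ofReal, map_ofNat]
  have hpi : (Real.pi : ℂ) ≠ 0 := by exact_mod_cast Real.pi_ne_zero
  field_simp
  ring

lemma norm_cayley_lt (z : ℍ) : ‖((z : ℂ) - I) / (z + I)‖ < 1 := by
  rw [norm_div, div_lt_one (norm_pos_iff.mpr (add_I_ne_zero z))]
  refine lt_of_pow_lt_pow_left₀ 2 (norm_nonneg _) ?_
  rw [← Complex.normSq_eq_norm_sq, ← Complex.normSq_eq_norm_sq, Complex.normSq_apply,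
    Complex.normSq_apply]
  simp only [Complex.sub_re, Complex.sub_im, Complex.add_re, Complex.add_im, Complex.I_re,
    Complex.I_im, UpperHalfPlane.coe_im, UpperHalfPlane.coe_re]
  nlinarith [z.im_pos]

lemma kernelValue_cayley (b : HInfBall) (l z : ℍ) :
    kernelValue b l z = (1 / Real.pi : ℝ) * ((conj ((l : ℂ) + I))⁻¹ * ((z : ℂ) + I)⁻¹ *
      ((1 - conj (b l) * b z) /
        (1 - conj (((l : ℂ) - I) / (l + I)) * (((z : ℂ) - I) / (z + I))))) := by
  have h1 := sub_conj_ne_zero z l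
  have h2 := add_I_ne_zero z
  have h3 : conj (l : ℂ) - I ≠ 0 := by
    have := (map_ne_zero (starRingEnd ℂ)).mpr (add_I_ne_zero l)
    simpa [sub_eq_add_neg] using this
  have hpi : (Real.pi : ℂ) ≠ 0 := by exact_mod_cast Real.pi_ne_zero
  have e : 1 - conj (((l : ℂ) - I) / (l + I)) * (((z : ℂ) - I) / (z + I))
      = -(2 * I) * ((z : ℂ) - conj (l : ℂ)) / ((conj (l : ℂ) - I) * ((z : ℂ) + I)) := by
    simp only [map_div₀, map_sub, map_add, Complex.conj_I]
    rw [← sub_eq_add_neg]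
    field_simp
    ring
  rw [e]
  simp only [kernelValue, map_add, Complex.conj_I, ← sub_eq_add_neg]
  push_cast
  field_simp
  rw [Complex.I_sq]
  ring

lemma holo_cayley (b : HInfBall) : DifferentiableOn ℂ
    (fun w : ℂ => b (UpperHalfPlane.ofComplex (I * (1 + w) / (1 - w)))) (ball (0 : ℂ) 1) := by
  have hb := UpperHalfPlane.mdifferentiable_iff.mp b.holo
  have hne : ∀ w ∈ ball (0 : ℂ) 1, 1 - w ≠ 0 := by
    intro w hw h
    rw [← sub_eq_zero.mp h] at hw
    simp at hw
  refine DifferentiableOn.comp (t := {z : ℂ | 0 < z.im}) hb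
    (f := fun w : ℂ => I * (1 + w) / (1 - w)) ?_ ?_
  · exact DifferentiableOn.div (by fun_prop) (by fun_prop) hne
  · intro w hw
    have h1 := hne w hw
    have h2 : ‖w‖ ^ 2 < 1 := by
      have : ‖w‖ < 1 := by simpa using hw
      nlinarith [norm_nonneg w]
    rw [← Complex.normSq_eq_norm_sq, Complex.normSq_apply] at h2
    have h3 : 0 < Complex.normSq (1 - w) := Complex.normSq_pos.mpr h1
    have h4 : (I * (1 + w) / (1 - w)).im
        = (1 - (w.re * w.re + w.im * w.im)) / Complex.normSq (1 - w) := by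
      rw [Complex.div_im]
      simp only [Complex.mul_im, Complex.mul_re, Complex.I_re, Complex.I_im, Complex.add_re,
        Complex.add_im, Complex.sub_re, Complex.sub_im, Complex.one_re, Complex.one_im]
      field_simp
      ring
    change 0 < (I * (1 + w) / (1 - w)).im
    rw [h4]
    exact div_pos (by linarith) h3

lemma cayley_inv (z : ℍ) : UpperHalfPlane.ofComplex
    (I * (1 + ((z : ℂ) - I) / (z + I)) / (1 - ((z : ℂ) - I) / (z + I))) = z := by
  have h2 := add_I_ne_zero z
  have : I * (1 + ((z : ℂ) - I) / (z + I)) / (1 - ((z : ℂ) - I) / (z + I)) = z := by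
    have e1 : 1 + ((z : ℂ) - I) / (z + I) = 2 * z / (z + I) := by field_simp; ring
    have e2 : 1 - ((z : ℂ) - I) / (z + I) = 2 * I / (z + I) := by field_simp; ring
    rw [e1, e2]
    field_simp
  rw [this, UpperHalfPlane.ofComplex_apply]

lemma kernelValue_nonneg (b : HInfBall) (s : Finset ℍ) (a : ℍ → ℂ) :
    0 ≤ (∑ z ∈ s, ∑ l ∈ s, conj (a z) * a l * kernelValue b l z).re := by
  have h := disc_nonneg s (fun z : ℍ => ((z : ℂ) - I) / (z + I))
    (fun z : ℍ => a z * (conj ((z : ℂ) + I))⁻¹) norm_cayley_lt (holo_cayley b)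
    (fun w _ => b.bound _)
  simp only [cayley_inv] at h
  have e : (∑ z ∈ s, ∑ l ∈ s, conj (a z) * a l * kernelValue b l z)
      = (1 / Real.pi : ℝ) * ∑ z ∈ s, ∑ l ∈ s, conj (a z * (conj ((z : ℂ) + I))⁻¹) *
        (a l * (conj ((l : ℂ) + I))⁻¹) * ((1 - conj (b l) * b z) /
        (1 - conj (((l : ℂ) - I) / (l + I)) * (((z : ℂ) - I) / (z + I)))) := by
    simp only [Finset.mul_sum]
    refine Finset.sum_congr rfl fun z _ => Finset.sum_congr rfl fun l _ => ?_
    rw [kernelValue_cayley, map_mul, map_inv₀, Complex.conj_conj]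
    ring
  rw [e, Complex.re_ofReal_mul]
  exact mul_nonneg (by positivity) h

lemma kernelMatrix_posSemidef (b : HInfBall) : (kernelMatrix b).PosSemidef := by
  have key := (RKHS.posSemidef_tfae (K := kernelMatrix b)).out 0 2
  refine key.mpr ⟨?_, fun v => ?_⟩
  · ext z l
    simp [Matrix.conjTranspose_apply, kernelMatrix, ← conj_kernelValue b l z,
      ContinuousLinearMap.star_eq_adjoint, ContinuousLinearMap.adjoint_id]
  · have h := kernelValue_nonneg b v.support fun z => v z
    have e : (v.sum fun x w => v.sum fun x' w' => inner ℂ (kernelMatrix b x' x w) w')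
        = conj (∑ z ∈ v.support, ∑ l ∈ v.support, conj (v z) * v l * kernelValue b l z) := by
      simp only [Finsupp.sum, map_sum]
      rw [Finset.sum_comm]
      refine Finset.sum_congr rfl fun z _ => Finset.sum_congr rfl fun l _ => ?_
      simp [kernelMatrix, RCLike.inner_apply]
      ring
    rw [e]
    change 0 ≤ (conj _ : ℂ).re
    rwa [Complex.conj_re]

instance (b : HInfBall) : Fact (kernelMatrix b).PosSemidef := ⟨kernelMatrix_posSemidef b⟩

/-- The de Branges--Rovnyak space `𝓗(b)`: the reproducing kernel Hilbert space of functions on `ℍ`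
with kernel `k_λ^b(z)`. -/
abbrev DBR (b : HInfBall) : Type := RKHS.OfKernel (kernelMatrix b)

/-- The reproducing kernel `k_λ^b` as an element of `𝓗(b)`. -/
noncomputable def repKernel (b : HInfBall) (l : ℍ) : DBR b := RKHS.kerFun (DBR b) l 1

lemma repKernel_apply (b : HInfBall) (l z : ℍ) : repKernel b l z = kernelValue b l z := by
  rw [repKernel, RKHS.kerFun_apply, RKHS.OfKernel.kernel_ofKernel]
  simp [kernelMatrix]

lemma inner_repKernel (b : HInfBall) (l : ℍ) (f : DBR b) : inner ℂ (repKernel b l) f = f l := by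
  simp [repKernel]

/-- The normalized reproducing kernel `κ_λ^b = k_λ^b / ‖k_λ^b‖_b`. -/
noncomputable def normKernel (b : HInfBall) (l : ℍ) : DBR b :=
  ((‖repKernel b l‖⁻¹ : ℝ) : ℂ) • repKernel b l

/-- `‖k_λ^{b₁}‖² / ‖k_λ^{b₂}‖²`. -/
noncomputable def kernelRatio (b₁ b₂ : HInfBall) (l : ℍ) : ℝ :=
  ‖repKernel b₁ l‖ ^ 2 / ‖repKernel b₂ l‖ ^ 2

lemma norm_repKernel_sq (b : HInfBall) (l : ℍ) :
    ‖repKernel b l‖ ^ 2 = (1 - ‖b l‖ ^ 2) / (4 * Real.pi * l.im) := by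
  have h : ((‖repKernel b l‖ ^ 2 : ℝ) : ℂ) = kernelValue b l l := by
    rw [← repKernel_apply, ← inner_repKernel, inner_self_eq_norm_sq_to_K]
    simp
  have hl : (l.im : ℂ) ≠ 0 := by exact_mod_cast l.im_pos.ne'
  have hpi : (Real.pi : ℂ) ≠ 0 := by exact_mod_cast Real.pi_ne_zero
  have h2 : kernelValue b l l = (((1 - ‖b l‖ ^ 2) / (4 * Real.pi * l.im) : ℝ) : ℂ) := by
    rw [kernelValue, Complex.conj_mul', Complex.sub_conj, UpperHalfPlane.coe_im]
    push_cast
    field_simp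
    ring
  exact_mod_cast h.trans h2

lemma kernelRatio_eq (b₁ b₂ : HInfBall) (l : ℍ) :
    kernelRatio b₁ b₂ l = (1 - ‖b₁ l‖ ^ 2) / (1 - ‖b₂ l‖ ^ 2) := by
  have h : 4 * Real.pi * l.im ≠ 0 := by have := l.im_pos; positivity
  rw [kernelRatio, norm_repKernel_sq, norm_repKernel_sq, div_div_div_cancel_right₀ h]

section AOB

variable {H : Type*} [NormedAddCommGroup H] [InnerProductSpace ℂ H]

/-- The defining property of an asymptotically orthonormal sequence with threshold `N₀`. Sequences
are indexed from `0`. -/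
def IsAOSFrom (N₀ : ℕ) (x : ℕ → H) : Prop :=
  ∃ c C : ℕ → ℝ,
    (∀ N, N₀ ≤ N → 0 < c N ∧ 0 < C N ∧ ∀ a : ℕ →₀ ℂ, (∀ n < N, a n = 0) →
      c N * (a.sum fun _ t => ‖t‖ ^ 2) ≤ ‖a.sum fun n t => t • x n‖ ^ 2 ∧
      ‖a.sum fun n t => t • x n‖ ^ 2 ≤ C N * (a.sum fun _ t => ‖t‖ ^ 2)) ∧
    Filter.Tendsto c Filter.atTop (nhds 1) ∧ Filter.Tendsto C Filter.atTop (nhds 1)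

/-- An asymptotically orthonormal basic sequence: the threshold is the first index. -/
def IsAOB (x : ℕ → H) : Prop := IsAOSFrom 0 x

/-- The closed linear span of the sequence is the whole space. -/
def IsCompleteSeq (x : ℕ → H) : Prop :=
  (Submodule.span ℂ (Set.range x)).topologicalClosure = ⊤

end AOB

end HbSpace

/-
Since `k_λ^{b₁} = k_λ^{b₂} + conj (b₂ λ) b₂ k_λ^b`, the Gram matrix of the vectors
`k_{λₙ}^{b₁} / ‖k_{λₙ}^{b₂}‖` is the Gram matrix of the `κ_{λₙ}^{b₂}` plus that of vectors whose
squared norms are the summable numbers `‖k_{λₙ}^{b₁}‖² / ‖k_{λₙ}^{b₂}‖² - 1`. Such a perturbation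
is negligible on tails, so both sequences have the same asymptotic bounds, and adding it preserves
every lower bound.

For completeness, `𝓗(b₂) ⊆ 𝓗(b₁)` shows that `(λₙ)` is a uniqueness sequence for `𝓗(b₂)`. Take
the least `p` from which the `κ_{λₙ}^{b₂}` are asymptotically orthonormal. The space `V` of
functions vanishing at the `λₙ` with `n ≥ p` is finite-dimensional. If `p > 0`, minimality forces
every function in `V` to vanish at `λ_{p-1}` too: otherwise it would separate the kernel at
`λ_{p-1}` from the later ones, and the sequence could be started one step earlier. So `V` is
invariant under division by the Blaschke factor of `λ_{p-1}`; this operator has no eigenvectors,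
hence `V = 0`.
-/

namespace HbSpace

open Filter Finsupp Set Topology
open scoped InnerProductSpace UpperHalfPlane

section RieszBounds

variable {ι κ H : Type*} [NormedAddCommGroup H] [InnerProductSpace ℂ H]
  {x : ι → H} {s t : Set ι} {c C r : ℝ}

/-- `c` is a lower Riesz bound for the subfamily of `x` indexed by `s`. -/
def LowerRieszBound (x : ι → H) (s : Set ι) (c : ℝ) : Prop :=
  ∀ a ∈ supported ℂ ℂ s, c * (a.sum fun _ z => ‖z‖ ^ 2) ≤ ‖linearCombination ℂ x a‖ ^ 2

/-- `C` is an upper Riesz bound for the subfamily of `x` indexed by `s`. -/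
def UpperRieszBound (x : ι → H) (s : Set ι) (C : ℝ) : Prop :=
  ∀ a ∈ supported ℂ ℂ s, ‖linearCombination ℂ x a‖ ^ 2 ≤ C * (a.sum fun _ z => ‖z‖ ^ 2)

lemma sum_norm_sq_nonneg (a : ι →₀ ℂ) : 0 ≤ a.sum fun _ z => ‖z‖ ^ 2 :=
  Finset.sum_nonneg fun _ _ => by positivity

lemma LowerRieszBound.mono (h : LowerRieszBound x s C) (hst : t ⊆ s) (hc : c ≤ C) :
    LowerRieszBound x t c := fun a ha =>
  (mul_le_mul_of_nonneg_right hc (sum_norm_sq_nonneg a)).trans (h a (supported_mono hst ha))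

lemma UpperRieszBound.mono (h : UpperRieszBound x s c) (hst : t ⊆ s) (hc : c ≤ C) :
    UpperRieszBound x t C := fun a ha =>
  (h a (supported_mono hst ha)).trans (mul_le_mul_of_nonneg_right hc (sum_norm_sq_nonneg a))

/-- The coefficients of `∑ aᵢ wᵢ xᵢ` with respect to `x`. -/
noncomputable def weightedCoeff (w : ι → ℂ) (a : ι →₀ ℂ) : ι →₀ ℂ :=
  onFinset a.support (fun i => w i * a i) fun _ hi => mem_support_iff.mpr (right_ne_zero_of_mul hi)

lemma linearCombination_weightedCoeff (w : ι → ℂ) (a : ι →₀ ℂ) :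
    linearCombination ℂ x (weightedCoeff w a) = linearCombination ℂ (fun i => w i • x i) a := by
  rw [weightedCoeff, linearCombination_onFinset, linearCombination_apply]
  simp only [Finsupp.sum, smul_smul, mul_comm]

lemma sum_norm_sq_weightedCoeff (w : ι → ℂ) (a : ι →₀ ℂ) :
    ((weightedCoeff w a).sum fun _ z => ‖z‖ ^ 2) = a.sum fun i z => ‖w i‖ ^ 2 * ‖z‖ ^ 2 := by
  rw [weightedCoeff, onFinset_sum _ (by simp)]
  simp only [norm_mul, mul_pow, Finsupp.sum]

lemma weightedCoeff_mem_supported (w : ι → ℂ) {a : ι →₀ ℂ} (ha : a ∈ supported ℂ ℂ s) :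
    weightedCoeff w a ∈ supported ℂ ℂ s :=
  mem_supported' ℂ _ |>.mpr fun i hi => by
    simp [weightedCoeff, (mem_supported' ℂ a).mp ha i hi]

lemma LowerRieszBound.smul (h : LowerRieszBound x s c) (hc : 0 ≤ c) {w : ι → ℂ}
    (hw : ∀ i ∈ s, r ≤ ‖w i‖ ^ 2) : LowerRieszBound (fun i => w i • x i) s (c * r) := by
  intro a ha
  have hx := h _ (weightedCoeff_mem_supported w ha)
  rw [linearCombination_weightedCoeff, sum_norm_sq_weightedCoeff] at hx
  refine le_trans ?_ hx
  rw [mul_assoc, Finsupp.sum, Finsupp.sum, Finset.mul_sum _ _ r]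
  gcongr with i hi
  exact hw i (ha hi)

lemma UpperRieszBound.smul (h : UpperRieszBound x s C) (hC : 0 ≤ C) {w : ι → ℂ}
    (hw : ∀ i ∈ s, ‖w i‖ ^ 2 ≤ r) : UpperRieszBound (fun i => w i • x i) s (C * r) := by
  intro a ha
  have hx := h _ (weightedCoeff_mem_supported w ha)
  rw [linearCombination_weightedCoeff, sum_norm_sq_weightedCoeff] at hx
  refine hx.trans ?_
  rw [mul_assoc, Finsupp.sum, Finsupp.sum, Finset.mul_sum _ _ r]
  gcongr with i hi
  exact hw i (ha hi)

lemma LowerRieszBound.comp (h : LowerRieszBound x s c) {φ : κ → ι} (hφ : φ.Injective)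
    {t : Set κ} (hts : MapsTo φ t s) : LowerRieszBound (x ∘ φ) t c := by
  intro a ha
  have hx := h (a.mapDomain φ) (supported_comap_lmapDomain ℂ ℂ φ s (supported_mono hts ha))
  rwa [linearCombination_mapDomain, sum_mapDomain_index_inj hφ] at hx

lemma UpperRieszBound.comp (h : UpperRieszBound x s C) {φ : κ → ι} (hφ : φ.Injective)
    {t : Set κ} (hts : MapsTo φ t s) : UpperRieszBound (x ∘ φ) t C := by
  intro a ha
  have hx := h (a.mapDomain φ) (supported_comap_lmapDomain ℂ ℂ φ s (supported_mono hts ha))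
  rwa [linearCombination_mapDomain, sum_mapDomain_index_inj hφ] at hx

lemma LowerRieszBound.linearIndepOn (h : LowerRieszBound x s c) (hc : 0 < c) :
    LinearIndepOn ℂ x s := by
  rw [linearIndepOn_iff]
  intro a ha h0
  have hx := h a ha
  rw [h0, norm_zero, zero_pow two_ne_zero] at hx
  have hsum : (a.sum fun _ z => ‖z‖ ^ 2) = 0 :=
    (nonpos_of_mul_nonpos_right hx hc).antisymm (sum_norm_sq_nonneg a)
  rw [Finsupp.sum, Finset.sum_eq_zero_iff_of_nonneg fun _ _ => by positivity] at hsum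
  ext i
  by_contra hi
  exact hi (by simpa using hsum i (mem_support_iff.mpr hi))

lemma UpperRieszBound.of_sum_le {e : ι → H}
    (h : ∀ u : Finset ι, ↑u ⊆ s → ∑ i ∈ u, ‖e i‖ ^ 2 ≤ C) : UpperRieszBound e s C := by
  intro a ha
  calc ‖linearCombination ℂ e a‖ ^ 2 ≤ (∑ i ∈ a.support, ‖a i‖ * ‖e i‖) ^ 2 := by
        gcongr
        exact (norm_sum_le _ _).trans_eq (by simp [norm_smul])
    _ ≤ (∑ i ∈ a.support, ‖a i‖ ^ 2) * ∑ i ∈ a.support, ‖e i‖ ^ 2 :=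
        Finset.sum_mul_sq_le_sq_mul_sq _ _ _
    _ ≤ (∑ i ∈ a.support, ‖a i‖ ^ 2) * C := by
        gcongr
        exact h _ ha
    _ = C * a.sum fun _ z => ‖z‖ ^ 2 := mul_comm _ _

lemma UpperRieszBound.of_summable {e : ι → H} (he : Summable fun i => ‖e i‖ ^ 2) :
    UpperRieszBound e s (∑' i, ‖e i‖ ^ 2) :=
  .of_sum_le fun u _ => he.sum_le_tsum u fun _ _ => by positivity

lemma eventually_upperRieszBound_Ici {e : ℕ → H} (he : Summable fun n => ‖e n‖ ^ 2)
    (hC : 0 < C) : ∀ᶠ N in atTop, UpperRieszBound e (Ici N) C := by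
  obtain ⟨u, hu⟩ := summable_iff_vanishing_norm.mp he C hC
  obtain ⟨M, hM⟩ := u.exists_nat_subset_range
  filter_upwards [eventually_ge_atTop M] with N hN
  refine .of_sum_le fun v hv => (le_abs_self _).trans (hu v ?_).le
  refine Finset.disjoint_left.mpr fun n hnv hnu => ?_
  have := hv hnv
  have := Finset.mem_range.mp (hM hnu)
  simp only [mem_Ici] at *
  lia

lemma erase_mem_supported {p : ι} {a : ι →₀ ℂ} (ha : a ∈ supported ℂ ℂ (insert p s)) :
    a.erase p ∈ supported ℂ ℂ s := by
  classical
  intro i hi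
  rw [Finset.mem_coe, support_erase, Finset.mem_erase] at hi
  exact (ha hi.2).resolve_left hi.1

lemma linearCombination_eq_add_erase (x : ι → H) (a : ι →₀ ℂ) (p : ι) :
    linearCombination ℂ x a = a p • x p + linearCombination ℂ x (a.erase p) :=
  (add_sum_erase' a p _ (by simp)).symm

lemma sum_norm_sq_eq_add_erase (a : ι →₀ ℂ) (p : ι) :
    (a.sum fun _ z => ‖z‖ ^ 2) = ‖a p‖ ^ 2 + (a.erase p).sum fun _ z => ‖z‖ ^ 2 :=
  (add_sum_erase' a p (fun _ z => ‖z‖ ^ 2) (by simp)).symm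

lemma UpperRieszBound.exists_insert (h : UpperRieszBound x s C) (p : ι) :
    ∃ C', UpperRieszBound x (insert p s) C' := by
  refine ⟨2 * max (‖x p‖ ^ 2) C, fun a ha => ?_⟩
  have hS := sum_norm_sq_nonneg (a.erase p)
  have hx := h _ (erase_mem_supported ha)
  rw [linearCombination_eq_add_erase x a p, sum_norm_sq_eq_add_erase a p]
  set y := linearCombination ℂ x (a.erase p)
  calc ‖a p • x p + y‖ ^ 2 ≤ (‖a p • x p‖ + ‖y‖) ^ 2 := by gcongr; exact norm_add_le _ _
    _ ≤ 2 * (‖a p • x p‖ ^ 2 + ‖y‖ ^ 2) := add_sq_le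
    _ ≤ 2 * (‖x p‖ ^ 2 * ‖a p‖ ^ 2 + C * (a.erase p).sum fun _ z => ‖z‖ ^ 2) := by
        rw [norm_smul, mul_pow, mul_comm (‖a p‖ ^ 2)]
        gcongr
    _ ≤ 2 * (max (‖x p‖ ^ 2) C * ‖a p‖ ^ 2
          + max (‖x p‖ ^ 2) C * (a.erase p).sum fun _ z => ‖z‖ ^ 2) := by
        gcongr
        exacts [le_max_left _ _, le_max_right _ _]
    _ = _ := by ring

lemma norm_coeff_le_of_inner_ne_zero {f : H} {p : ι} (hf : ∀ i ∈ s, ⟪f, x i⟫_ℂ = 0)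
    (hfp : ⟪f, x p⟫_ℂ ≠ 0) {a : ι →₀ ℂ} (ha : a ∈ supported ℂ ℂ (insert p s)) :
    ‖a p‖ ≤ ‖f‖ / ‖⟪f, x p⟫_ℂ‖ * ‖linearCombination ℂ x a‖ := by
  have hrest : ⟪f, linearCombination ℂ x (a.erase p)⟫_ℂ = 0 := by
    rw [linearCombination_apply, Finsupp.sum, inner_sum]
    exact Finset.sum_eq_zero fun i hi => by
      rw [inner_smul_right, hf i (erase_mem_supported ha hi), mul_zero]
  have hinner : ⟪f, linearCombination ℂ x a⟫_ℂ = a p * ⟪f, x p⟫_ℂ := by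
    rw [linearCombination_eq_add_erase x a p, inner_add_right, hrest, inner_smul_right, add_zero]
  rw [div_mul_eq_mul_div, le_div_iff₀ (norm_pos_iff.mpr hfp), ← norm_mul, ← hinner]
  exact norm_inner_le_norm f _

lemma LowerRieszBound.exists_insert (h : LowerRieszBound x s c) (hc : 0 < c) {f : H} {p : ι}
    (hf : ∀ i ∈ s, ⟪f, x i⟫_ℂ = 0) (hfp : ⟪f, x p⟫_ℂ ≠ 0) :
    ∃ c' > 0, LowerRieszBound x (insert p s) c' := by
  have hf0 : f ≠ 0 := by
    rintro rfl
    exact hfp (inner_zero_left _)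
  set D := ‖f‖ / ‖⟪f, x p⟫_ℂ‖
  have : 0 < D := by positivity
  set B := D ^ 2 + (1 + D * ‖x p‖) ^ 2 / c with hB
  have hBpos : 0 < B := by positivity
  refine ⟨B⁻¹, inv_pos.mpr hBpos, fun a ha => ?_⟩
  have hap := norm_coeff_le_of_inner_ne_zero hf hfp ha
  have hx := h _ (erase_mem_supported ha)
  set v := linearCombination ℂ x a with hv
  set y := linearCombination ℂ x (a.erase p) with hy
  have hyv : ‖y‖ ≤ (1 + D * ‖x p‖) * ‖v‖ :=
    calc ‖y‖ = ‖v - a p • x p‖ := by rw [hv, linearCombination_eq_add_erase x a p, ← hy]; abel_nf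
      _ ≤ ‖v‖ + ‖a p‖ * ‖x p‖ := by
          rw [← norm_smul]
          exact norm_sub_le _ _
      _ ≤ ‖v‖ + D * ‖v‖ * ‖x p‖ := by gcongr
      _ = _ := by ring
  rw [sum_norm_sq_eq_add_erase a p, inv_mul_le_iff₀ hBpos]
  calc ‖a p‖ ^ 2 + (a.erase p).sum (fun _ z => ‖z‖ ^ 2)
      ≤ (D * ‖v‖) ^ 2 + ((1 + D * ‖x p‖) * ‖v‖) ^ 2 / c := by
        gcongr
        rw [le_div_iff₀' hc]
        exact hx.trans (by gcongr)
    _ = B * ‖v‖ ^ 2 := by rw [hB]; ring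

end RieszBounds

section AsymptoticallyOrthonormal

variable {H : Type*} [NormedAddCommGroup H] [InnerProductSpace ℂ H] {x : ℕ → H} {p : ℕ}

lemma exists_seq_tendsto_of_eventually {X : Type*} [PseudoMetricSpace X] {S : ℕ → Set X} {l : X}
    (hne : ∀ N, p ≤ N → (S N).Nonempty)
    (h : ∀ ε > 0, ∀ᶠ N in atTop, ∃ c ∈ S N, dist l c < ε) :
    ∃ c : ℕ → X, (∀ N, p ≤ N → c N ∈ S N) ∧ Tendsto c atTop (𝓝 l) := by
  have hnear (N : ℕ) : ∃ c, p ≤ N → c ∈ S N ∧ dist l c < Metric.infDist l (S N) + 1 / (N + 1) := by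
    by_cases hN : p ≤ N
    · obtain ⟨c, hc⟩ := (Metric.infDist_lt_iff (hne N hN)).mp
        (lt_add_of_pos_right _ (Nat.one_div_pos_of_nat (n := N)))
      exact ⟨c, fun _ => hc⟩
    · exact ⟨l, fun h => absurd h hN⟩
  choose c hc using hnear
  refine ⟨c, fun N hN => (hc N hN).1, Metric.tendsto_nhds.mpr fun ε hε => ?_⟩
  have hinv : ∀ᶠ N : ℕ in atTop, 1 / ((N : ℝ) + 1) < ε / 2 :=
    tendsto_one_div_add_atTop_nhds_zero_nat.eventually_lt_const (half_pos hε)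
  filter_upwards [eventually_ge_atTop p, h _ (half_pos hε), hinv] with N hN ⟨c', hc', hlt⟩ hinv
  rw [dist_comm]
  linarith [(hc N hN).2, Metric.infDist_le_dist_of_mem (x := l) hc']

lemma mem_supported_Ici_iff {a : ℕ →₀ ℂ} {N : ℕ} :
    a ∈ supported ℂ ℂ (Ici N) ↔ ∀ n < N, a n = 0 := by
  simp [mem_supported']

lemma isAOSFrom_iff_exists_bounds :
    IsAOSFrom p x ↔ ∃ c C : ℕ → ℝ,
      (∀ N, p ≤ N → 0 < c N ∧ LowerRieszBound x (Ici N) (c N)) ∧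
      (∀ N, p ≤ N → 0 < C N ∧ UpperRieszBound x (Ici N) (C N)) ∧
      Tendsto c atTop (𝓝 1) ∧ Tendsto C atTop (𝓝 1) := by
  simp only [LowerRieszBound, UpperRieszBound, mem_supported_Ici_iff]
  constructor
  · rintro ⟨c, C, h, hc, hC⟩
    exact ⟨c, C, fun N hN => ⟨(h N hN).1, fun a ha => ((h N hN).2.2 a ha).1⟩,
      fun N hN => ⟨(h N hN).2.1, fun a ha => ((h N hN).2.2 a ha).2⟩, hc, hC⟩
  · rintro ⟨c, C, hlower, hupper, hc, hC⟩
    exact ⟨c, C, fun N hN => ⟨(hlower N hN).1, (hupper N hN).1, fun a ha =>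
      ⟨(hlower N hN).2 a ha, (hupper N hN).2 a ha⟩⟩, hc, hC⟩

lemma isAOSFrom_iff :
    IsAOSFrom p x ↔
      (∃ c > 0, LowerRieszBound x (Ici p) c) ∧ (∃ C > 0, UpperRieszBound x (Ici p) C) ∧
      (∀ c ∈ Ioo (0 : ℝ) 1, ∀ᶠ N in atTop, LowerRieszBound x (Ici N) c) ∧
      ∀ C > (1 : ℝ), ∀ᶠ N in atTop, UpperRieszBound x (Ici N) C := by
  rw [isAOSFrom_iff_exists_bounds]
  constructor
  · rintro ⟨c, C, hlower, hupper, hc, hC⟩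
    refine ⟨⟨c p, hlower p le_rfl⟩, ⟨C p, hupper p le_rfl⟩, fun c' hc' => ?_, fun C' hC' => ?_⟩
    · filter_upwards [eventually_ge_atTop p, hc.eventually_const_lt hc'.2] with N hN hlt
      exact (hlower N hN).2.mono subset_rfl hlt.le
    · filter_upwards [eventually_ge_atTop p, hC.eventually_lt_const hC'] with N hN hlt
      exact (hupper N hN).2.mono subset_rfl hlt.le
  · rintro ⟨⟨c₀, hc₀, hlower⟩, ⟨C₀, hC₀, hupper⟩, hc, hC⟩
    obtain ⟨c, hcmem, hctend⟩ := exists_seq_tendsto_of_eventually (p := p) (l := (1 : ℝ))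
      (S := fun N => {c | 0 < c ∧ LowerRieszBound x (Ici N) c})
      (fun N hN => ⟨c₀, hc₀, hlower.mono (Ici_subset_Ici.mpr hN) le_rfl⟩) fun ε hε => by
        obtain ⟨c, hmax, hlt⟩ := exists_between (max_lt zero_lt_one (sub_lt_self (1 : ℝ) hε))
        obtain ⟨hpos, hclose⟩ := max_lt_iff.mp hmax
        filter_upwards [hc c ⟨hpos, hlt⟩] with N hN
        exact ⟨c, ⟨hpos, hN⟩, abs_lt.mpr ⟨by linarith, by linarith⟩⟩
    obtain ⟨C, hCmem, hCtend⟩ := exists_seq_tendsto_of_eventually (p := p) (l := (1 : ℝ))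
      (S := fun N => {C | 0 < C ∧ UpperRieszBound x (Ici N) C})
      (fun N hN => ⟨C₀, hC₀, hupper.mono (Ici_subset_Ici.mpr hN) le_rfl⟩) fun ε hε => by
        obtain ⟨C, hgt, hclose⟩ := exists_between (lt_add_of_pos_right (1 : ℝ) hε)
        filter_upwards [hC C hgt] with N hN
        exact ⟨C, ⟨by linarith, hN⟩, abs_lt.mpr ⟨by linarith, by linarith⟩⟩
    exact ⟨c, C, hcmem, hCmem, hctend, hCtend⟩

lemma IsAOSFrom.smul (hx : IsAOSFrom p x) {w : ℕ → ℂ} (hw : ∀ n, w n ≠ 0)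
    (hw1 : Tendsto (fun n => ‖w n‖) atTop (𝓝 1)) : IsAOSFrom p fun n => w n • x n := by
  have hw2 : Tendsto (fun n => ‖w n‖ ^ 2) atTop (𝓝 1) := by simpa using hw1.pow 2
  have hpos (n : ℕ) : 0 < ‖w n‖ ^ 2 := by have := hw n; positivity
  obtain ⟨⟨c₀, hc₀, hlower⟩, ⟨C₀, hC₀, hupper⟩, hc, hC⟩ := isAOSFrom_iff.mp hx
  refine isAOSFrom_iff.mpr ⟨?_, ?_, fun c hc' => ?_, fun C hC' => ?_⟩
  · obtain ⟨R, hR⟩ := (hw2.inv₀ one_ne_zero).bddAbove_range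
    have hinv (n : ℕ) : (‖w n‖ ^ 2)⁻¹ ≤ R := hR ⟨n, rfl⟩
    have hR0 : 0 < R := (inv_pos.mpr (hpos 0)).trans_le (hinv 0)
    exact ⟨c₀ * R⁻¹, by positivity,
      hlower.smul hc₀.le fun n _ => inv_le_of_inv_le₀ (hpos n) (hinv n)⟩
  · obtain ⟨R, hR⟩ := hw2.bddAbove_range
    have hR' (n : ℕ) : ‖w n‖ ^ 2 ≤ R := hR ⟨n, rfl⟩
    have hR0 : 0 < R := (hpos 0).trans_le (hR' 0)
    exact ⟨C₀ * R, by positivity, hupper.smul hC₀.le fun n _ => hR' n⟩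
  · have hsqrt : √c < 1 := by simpa using Real.sqrt_lt_sqrt hc'.1.le hc'.2
    filter_upwards [hc √c ⟨Real.sqrt_pos.mpr hc'.1, hsqrt⟩,
      eventually_forall_ge_atTop.mpr (hw2.eventually_const_lt hsqrt)] with N hN hwN
    rw [← Real.mul_self_sqrt hc'.1.le]
    exact hN.smul (Real.sqrt_nonneg c) fun n hn => (hwN n hn).le
  · have hsqrt : 1 < √C := by simpa using Real.sqrt_lt_sqrt zero_le_one hC'
    filter_upwards [hC √C hsqrt,
      eventually_forall_ge_atTop.mpr (hw2.eventually_lt_const hsqrt)] with N hN hwN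
    rw [← Real.mul_self_sqrt (zero_lt_one.trans hC').le]
    exact hN.smul (Real.sqrt_nonneg C) fun n hn => (hwN n hn).le

lemma IsAOSFrom.isAOB_comp_add (hx : IsAOSFrom p x) : IsAOB fun n => x (n + p) := by
  obtain ⟨⟨c₀, hc₀, hlower⟩, ⟨C₀, hC₀, hupper⟩, hc, hC⟩ := isAOSFrom_iff.mp hx
  have hinj : Function.Injective (· + p) := add_left_injective p
  have hmaps (N : ℕ) : MapsTo (· + p) (Ici N) (Ici (N + p)) := fun n hn =>
    Nat.add_le_add_right hn p
  refine isAOSFrom_iff.mpr ⟨⟨c₀, hc₀, hlower.comp hinj (by simp)⟩,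
    ⟨C₀, hC₀, hupper.comp hinj (by simp)⟩, fun c hc' => ?_, fun C hC' => ?_⟩
  · filter_upwards [tendsto_add_atTop_nat p |>.eventually (hc c hc')] with N hN
    exact hN.comp hinj (hmaps N)
  · filter_upwards [tendsto_add_atTop_nat p |>.eventually (hC C hC')] with N hN
    exact hN.comp hinj (hmaps N)

lemma IsAOSFrom.of_succ (hx : IsAOSFrom (p + 1) x) {f : H} (hf : ∀ n > p, ⟪f, x n⟫_ℂ = 0)
    (hfp : ⟪f, x p⟫_ℂ ≠ 0) : IsAOSFrom p x := by
  obtain ⟨⟨c₀, hc₀, hlower⟩, ⟨C₀, -, hupper⟩, hc, hC⟩ := isAOSFrom_iff.mp hx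
  have hinsert : insert p (Ici (p + 1)) = Ici p := by
    rw [← Order.succ_eq_add_one, Order.Ici_succ, Ioi_insert]
  obtain ⟨c, hc', hlower'⟩ := hlower.exists_insert hc₀ (fun n hn => hf n hn) hfp
  obtain ⟨C, hupper'⟩ := hupper.exists_insert p
  rw [hinsert] at hlower' hupper'
  exact isAOSFrom_iff.mpr ⟨⟨c, hc', hlower'⟩,
    ⟨max C 1, by positivity, hupper'.mono subset_rfl (le_max_left _ _)⟩, hc, hC⟩

lemma IsAOB.injective (hx : IsAOB x) : Function.Injective x := by
  obtain ⟨⟨c, hc, hlower⟩, -⟩ := isAOSFrom_iff.mp hx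
  exact injOn_univ.mp (by simpa using (hlower.linearIndepOn hc).injOn)

end AsymptoticallyOrthonormal

section GramSum

variable {ι H K L : Type*} [NormedAddCommGroup H] [InnerProductSpace ℂ H]
  [NormedAddCommGroup K] [InnerProductSpace ℂ K] [NormedAddCommGroup L]
  [InnerProductSpace ℂ L]

/-- The Gram matrix of `x` is the sum of the Gram matrices of `y` and `e`. -/
def IsGramSum (x : ι → H) (y : ι → K) (e : ι → L) : Prop :=
  ∀ i j, ⟪x i, x j⟫_ℂ = ⟪y i, y j⟫_ℂ + ⟪e i, e j⟫_ℂ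

namespace IsGramSum

variable {x : ι → H} {y : ι → K} {e : ι → L}

lemma norm_linearCombination_sq (h : IsGramSum x y e) (a : ι →₀ ℂ) :
    ‖linearCombination ℂ x a‖ ^ 2
      = ‖linearCombination ℂ y a‖ ^ 2 + ‖linearCombination ℂ e a‖ ^ 2 := by
  have hinner : ⟪linearCombination ℂ x a, linearCombination ℂ x a⟫_ℂ
      = ⟪linearCombination ℂ y a, linearCombination ℂ y a⟫_ℂ
        + ⟪linearCombination ℂ e a, linearCombination ℂ e a⟫_ℂ := by
    simp only [linearCombination_apply, Finsupp.sum, sum_inner, inner_sum, inner_smul_left,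
      inner_smul_right, h _ _, Finset.sum_add_distrib, mul_add]
  simp only [inner_self_eq_norm_sq_to_K] at hinner
  exact_mod_cast hinner

lemma norm_linearCombination_le (h : IsGramSum x y e) (a : ι →₀ ℂ) :
    ‖linearCombination ℂ y a‖ ≤ ‖linearCombination ℂ x a‖ := by
  refine le_of_sq_le_sq ?_ (norm_nonneg _)
  rw [h.norm_linearCombination_sq]
  exact le_add_of_nonneg_right (by positivity)

lemma norm_sq_eq (h : IsGramSum x y e) (i : ι) : ‖x i‖ ^ 2 = ‖y i‖ ^ 2 + ‖e i‖ ^ 2 := by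
  simpa using h.norm_linearCombination_sq (single i 1)

lemma exists_clm_inner_eq [CompleteSpace H] [CompleteSpace K] (h : IsGramSum x y e)
    (hx : Dense (Submodule.span ℂ (range x) : Set H)) :
    ∃ T : K →L[ℂ] H, ∀ f i, ⟪x i, T f⟫_ℂ = ⟪y i, f⟫_ℂ := by
  have hdense : DenseRange (linearCombination ℂ x) := by
    rwa [DenseRange, ← LinearMap.coe_range, range_linearCombination]
  have hbound : ∃ C, ∀ a, ‖linearCombination ℂ y a‖ ≤ C * ‖linearCombination ℂ x a‖ :=
    ⟨1, fun a => by simpa using h.norm_linearCombination_le a⟩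
  set E : H →L[ℂ] K := (linearCombination ℂ y).extendOfNorm (linearCombination ℂ x)
  have hE (i : ι) : E (x i) = y i := by
    simpa using LinearMap.extendOfNorm_eq hdense hbound (single i 1)
  exact ⟨E.adjoint, fun f i => by rw [ContinuousLinearMap.adjoint_inner_right, hE]⟩

lemma lowerRieszBound (h : IsGramSum x y e) {s : Set ι} {c : ℝ} (hy : LowerRieszBound y s c) :
    LowerRieszBound x s c := fun a ha => by
  rw [h.norm_linearCombination_sq]
  linarith [hy a ha, sq_nonneg ‖linearCombination ℂ e a‖]

lemma upperRieszBound (h : IsGramSum x y e) {s : Set ι} {C D : ℝ} (hy : UpperRieszBound y s C)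
    (he : UpperRieszBound e s D) : UpperRieszBound x s (C + D) := fun a ha => by
  rw [h.norm_linearCombination_sq, add_mul]
  exact add_le_add (hy a ha) (he a ha)

lemma lowerRieszBound_left (h : IsGramSum x y e) {s : Set ι} {c D : ℝ}
    (hx : LowerRieszBound x s c) (he : UpperRieszBound e s D) : LowerRieszBound y s (c - D) :=
  fun a ha => by
  rw [sub_mul]
  linarith [hx a ha, he a ha, h.norm_linearCombination_sq a]

lemma upperRieszBound_left (h : IsGramSum x y e) {s : Set ι} {C : ℝ}
    (hx : UpperRieszBound x s C) : UpperRieszBound y s C := fun a ha => by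
  linarith [hx a ha, h.norm_linearCombination_sq a, sq_nonneg ‖linearCombination ℂ e a‖]

end IsGramSum

section Sequences

variable {x : ℕ → H} {y : ℕ → K} {e : ℕ → L} {p : ℕ}

lemma IsGramSum.isAOSFrom (h : IsGramSum x y e) (he : Summable fun n => ‖e n‖ ^ 2)
    (hy : IsAOSFrom p y) : IsAOSFrom p x := by
  obtain ⟨⟨c₀, hc₀, hlower⟩, ⟨C₀, hC₀, hupper⟩, hc, hC⟩ := isAOSFrom_iff.mp hy
  refine isAOSFrom_iff.mpr ⟨⟨c₀, hc₀, h.lowerRieszBound hlower⟩,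
    ⟨_, ?_, h.upperRieszBound hupper (.of_summable he)⟩, fun c hc' => ?_, fun C hC' => ?_⟩
  · exact add_pos_of_pos_of_nonneg hC₀ (tsum_nonneg fun _ => sq_nonneg _)
  · filter_upwards [hc c hc'] with N hN
    exact h.lowerRieszBound hN
  · obtain ⟨C₁, h1, h2⟩ := exists_between hC'
    filter_upwards [hC C₁ h1, eventually_upperRieszBound_Ici he (sub_pos.mpr h2)] with N hN heN
    exact (h.upperRieszBound hN heN).mono subset_rfl (add_sub_cancel _ _).le

lemma IsGramSum.exists_isAOSFrom_left (h : IsGramSum x y e) (he : Summable fun n => ‖e n‖ ^ 2)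
    (hx : IsAOSFrom p x) : ∃ q, IsAOSFrom q y := by
  obtain ⟨-, ⟨C₀, hC₀, hupper⟩, hc, hC⟩ := isAOSFrom_iff.mp hx
  have hlower (c : ℝ) (hc' : c ∈ Ioo (0 : ℝ) 1) : ∀ᶠ N in atTop, LowerRieszBound y (Ici N) c := by
    obtain ⟨c₁, h1, h2⟩ := exists_between hc'.2
    filter_upwards [hc c₁ ⟨hc'.1.trans h1, h2⟩,
      eventually_upperRieszBound_Ici he (sub_pos.mpr h1)] with N hN heN
    exact (h.lowerRieszBound_left hN heN).mono subset_rfl (sub_sub_cancel _ _).ge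
  obtain ⟨q, hq, hpq⟩ := ((hlower (1 / 2) (by norm_num)).and (eventually_ge_atTop p)).exists
  refine ⟨q, isAOSFrom_iff.mpr ⟨⟨1 / 2, by norm_num, hq⟩,
    ⟨C₀, hC₀, (h.upperRieszBound_left hupper).mono (Ici_subset_Ici.mpr hpq) le_rfl⟩, hlower,
    fun C hC' => ?_⟩⟩
  filter_upwards [hC C hC'] with N hN
  exact h.upperRieszBound_left hN

end Sequences

end GramSum

section Completeness

variable {H : Type*} [NormedAddCommGroup H] [InnerProductSpace ℂ H]

lemma dense_span_range_iff [CompleteSpace H] {ι : Type*} {x : ι → H} :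
    Dense (Submodule.span ℂ (range x) : Set H) ↔ ∀ f : H, (∀ i, ⟪x i, f⟫_ℂ = 0) → f = 0 := by
  rw [Submodule.dense_iff_topologicalClosure_eq_top, Submodule.topologicalClosure_eq_top_iff,
    Submodule.eq_bot_iff]
  refine forall_congr' fun f => imp_congr_left ?_
  rw [← Submodule.span_singleton_le_iff_mem, ← Submodule.isOrtho_iff_le, Submodule.isOrtho_comm,
    Submodule.isOrtho_span]
  simp

lemma isCompleteSeq_iff [CompleteSpace H] {x : ℕ → H} :
    IsCompleteSeq x ↔ ∀ f : H, (∀ n, ⟪x n, f⟫_ℂ = 0) → f = 0 := by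
  rw [IsCompleteSeq, ← Submodule.dense_iff_topologicalClosure_eq_top, dense_span_range_iff]

lemma continuous_of_continuous_inner {X : Type*} [TopologicalSpace X] {x : X → H}
    (h : Continuous fun q : X × X => ⟪x q.1, x q.2⟫_ℂ) : Continuous x := by
  refine continuous_iff_continuousAt.mpr fun w => tendsto_iff_norm_sub_tendsto_zero.mpr ?_
  have hsq (z : X) : ‖x z - x w‖ ^ 2
      = (⟪x z, x z⟫_ℂ - ⟪x z, x w⟫_ℂ - ⟪x w, x z⟫_ℂ + ⟪x w, x w⟫_ℂ).re := by
    rw [@norm_sq_eq_re_inner ℂ, inner_sub_sub_self]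
    rfl
  have hcont : Continuous fun z : X =>
      (⟪x z, x z⟫_ℂ - ⟪x z, x w⟫_ℂ - ⟪x w, x z⟫_ℂ + ⟪x w, x w⟫_ℂ).re :=
    Complex.continuous_re.comp <| (((h.comp (continuous_id.prodMk continuous_id)).sub
      (h.comp (continuous_id.prodMk continuous_const))).sub
      (h.comp (continuous_const.prodMk continuous_id))).add continuous_const
  have hlim : Tendsto (fun z => ‖x z - x w‖ ^ 2) (𝓝 w) (𝓝 0) := by
    simpa [hsq] using hcont.tendsto w
  simpa using hlim.sqrt

end Completeness

section Kernel

variable {b b₁ b₂ : HInfBall}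

lemma inner_repKernel_repKernel (b : HInfBall) (l z : ℍ) :
    ⟪repKernel b z, repKernel b l⟫_ℂ = kernelValue b l z := by
  rw [inner_repKernel, repKernel_apply]

lemma continuous_kernelValue (b : HInfBall) :
    Continuous fun q : ℍ × ℍ => kernelValue b q.2 q.1 := by
  have hb : Continuous b := b.holo.continuous
  have hcoe := UpperHalfPlane.continuous_coe
  refine continuous_const.mul (Continuous.div ?_ ?_ fun q => sub_conj_ne_zero q.1 q.2)
  · fun_prop
  · exact (hcoe.comp continuous_fst).sub (Complex.continuous_conj.comp (hcoe.comp continuous_snd))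

lemma continuous_repKernel (b : HInfBall) : Continuous (repKernel b) :=
  continuous_of_continuous_inner <| by
    simpa only [inner_repKernel_repKernel] using continuous_kernelValue b

lemma continuous_coe_DBR (f : DBR b) : Continuous f := by
  have h : Continuous fun z => ⟪repKernel b z, f⟫_ℂ :=
    (continuous_repKernel b).inner continuous_const
  simpa only [inner_repKernel] using h

lemma eq_zero_of_forall_notMem {f : DBR b} {s : Set ℍ} (hs : s.Finite)
    (h : ∀ z ∉ s, f z = 0) : f = 0 := by
  have hdense : Dense sᶜ := by simpa [compl_eq_univ_sdiff] using dense_univ.sdiff_finite hs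
  exact RKHS.ext fun z => by
    simpa using congrFun ((continuous_coe_DBR f).ext_on hdense continuous_const h) z

lemma dense_span_repKernel (b : HInfBall) :
    Dense (Submodule.span ℂ (range (repKernel b)) : Set (DBR b)) :=
  dense_span_range_iff.mpr fun f hf => RKHS.ext fun z => by simpa [inner_repKernel] using hf z

lemma kernelValue_of_mul (hdiv : ∀ z, b₁ z = b₂ z * b z) (l z : ℍ) :
    kernelValue b₁ l z = kernelValue b₂ l z + conj (b₂ l) * b₂ z * kernelValue b l z := by
  have := sub_conj_ne_zero z l
  simp only [kernelValue, hdiv, map_mul]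
  field_simp
  ring

lemma isGramSum_repKernel (hdiv : ∀ z, b₁ z = b₂ z * b z) :
    IsGramSum (repKernel b₁) (repKernel b₂) fun l => conj (b₂ l) • repKernel b l := fun z l => by
  simp only [inner_smul_left, inner_smul_right, inner_repKernel_repKernel, Complex.conj_conj,
    kernelValue_of_mul hdiv]
  ring

lemma exists_inclusion (hdiv : ∀ z, b₁ z = b₂ z * b z) :
    ∃ J : DBR b₂ →L[ℂ] DBR b₁, ∀ f z, J f z = f z := by
  obtain ⟨J, hJ⟩ := (isGramSum_repKernel hdiv).exists_clm_inner_eq (dense_span_repKernel b₁)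
  exact ⟨J, fun f z => by simpa only [inner_repKernel] using hJ f z⟩

lemma repKernel_eq_zero_of_eq_zero {l : ℍ} (h : repKernel b l = 0) (z : ℍ) :
    repKernel b z = 0 := by
  have hkernel : kernelValue b l z = 0 := by rw [← repKernel_apply, h]; simp
  have hprod : conj (b l) * b z = 1 := by
    have := sub_conj_ne_zero z l
    simp only [kernelValue, mul_eq_zero, div_eq_zero_iff, this, or_false] at hkernel
    exact (sub_eq_zero.mp (by simpa [Real.pi_ne_zero] using hkernel)).symm
  have hnorm : ‖b l‖ * ‖b z‖ = 1 := by simpa using congrArg norm hprod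
  have hz : ‖b z‖ = 1 := by
    nlinarith [b.bound l, b.bound z, norm_nonneg (b l), norm_nonneg (b z)]
  simpa [hz] using norm_repKernel_sq b z

lemma inner_normKernel_eq_zero_iff {l : ℍ} (hl : repKernel b l ≠ 0) {f : DBR b} :
    ⟪normKernel b l, f⟫_ℂ = 0 ↔ f l = 0 := by
  simp [normKernel, inner_smul_left, inner_repKernel, hl]

/-- The functions in `𝓗(b)` vanishing on `Λ`; `Λ` is a uniqueness set for `𝓗(b)` if this is `⊥`. -/
noncomputable def vanishingSubmodule (b : HInfBall) (Λ : Set ℍ) : Submodule ℂ (DBR b) where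
  carrier := {f | ∀ l ∈ Λ, f l = 0}
  add_mem' hf hg l hl := by simp [hf l hl, hg l hl]
  zero_mem' l _ := by simp
  smul_mem' c f hf l hl := by simp [hf l hl]

lemma mem_vanishingSubmodule {Λ : Set ℍ} {f : DBR b} :
    f ∈ vanishingSubmodule b Λ ↔ ∀ l ∈ Λ, f l = 0 := Iff.rfl

lemma isCompleteSeq_normKernel_iff {lam : ℕ → ℍ} (hlam : ∀ n, repKernel b (lam n) ≠ 0) :
    IsCompleteSeq (fun n => normKernel b (lam n)) ↔ vanishingSubmodule b (range lam) = ⊥ := by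
  simp only [isCompleteSeq_iff, inner_normKernel_eq_zero_iff (hlam _), Submodule.eq_bot_iff,
    mem_vanishingSubmodule, forall_mem_range]

lemma vanishingSubmodule_eq_bot_of_mul (hdiv : ∀ z, b₁ z = b₂ z * b z) {Λ : Set ℍ}
    (h : vanishingSubmodule b₁ Λ = ⊥) : vanishingSubmodule b₂ Λ = ⊥ := by
  obtain ⟨J, hJ⟩ := exists_inclusion hdiv
  refine (Submodule.eq_bot_iff _).mpr fun f hf => RKHS.ext fun z => ?_
  have hJf : J f = 0 := (Submodule.eq_bot_iff _).mp h _ fun l hl => by rw [hJ, hf l hl]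
  rw [← hJ, hJf]
  simp

lemma finiteDimensional_vanishingSubmodule {Λ F : Set ℍ} (hF : F.Finite)
    (h : vanishingSubmodule b (Λ ∪ F) = ⊥) : FiniteDimensional ℂ (vanishingSubmodule b Λ) := by
  have := hF.to_subtype
  let restrictF : vanishingSubmodule b Λ →ₗ[ℂ] (F → ℂ) :=
    { toFun := fun f l => (f : DBR b) l
      map_add' := fun f g => by ext; simp
      map_smul' := fun c f => by ext; simp }
  refine Module.Finite.of_injective restrictF ((injective_iff_map_eq_zero _).mpr fun f hf => ?_)
  refine Subtype.ext ((Submodule.eq_bot_iff _).mp h _ fun l hl => ?_)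
  exact hl.elim (f.2 l) fun hl => congrFun hf ⟨l, hl⟩

end Kernel

section Blaschke

variable {b : HInfBall} {m : ℍ}

/-- The Blaschke factor of the upper half-plane with zero `m`. -/
noncomputable def blaschke (m z : ℍ) : ℂ := ((z : ℂ) - m) / (z - conj (m : ℂ))

lemma blaschke_ne_zero {z : ℍ} (h : z ≠ m) : blaschke m z ≠ 0 :=
  div_ne_zero (sub_ne_zero.mpr fun h' => h (UpperHalfPlane.ext h')) (sub_conj_ne_zero z m)

lemma blaschke_injective (m : ℍ) : Function.Injective (blaschke m) := by
  intro z w h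
  rw [blaschke, blaschke, div_eq_div_iff (sub_conj_ne_zero z m) (sub_conj_ne_zero w m)] at h
  have hmul : ((m : ℂ) - conj (m : ℂ)) * (z - w) = 0 := by linear_combination h
  exact UpperHalfPlane.ext
    (sub_eq_zero.mp ((mul_eq_zero.mp hmul).resolve_left (sub_conj_ne_zero m m)))

/-- The coefficient of `k_m^b` in the rank-one defect of division by `blaschke m` on `𝓗(b)`. -/
noncomputable def blaschkeDefectCoeff (b : HInfBall) (m z : ℍ) : ℂ :=
  ((m : ℂ) - conj (m : ℂ)) * (b z - b m) / ((1 - conj (b m) * b m) * ((z : ℂ) - conj (m : ℂ)))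

lemma blaschke_mul_kernelValue (hm : kernelValue b m m ≠ 0) (w z : ℍ) :
    blaschke m z * conj (blaschke m w) * kernelValue b w z
      = kernelValue b w z - kernelValue b m z * kernelValue b w m / kernelValue b m m
        + blaschkeDefectCoeff b m z * conj (blaschkeDefectCoeff b m w) * kernelValue b m m := by
  have hb : 1 - conj (b m) * b m ≠ 0 := fun h => hm (by simp [kernelValue, h])
  have hzw := sub_conj_ne_zero z w
  have hzm := sub_conj_ne_zero z m
  have hmw := sub_conj_ne_zero m w
  have hmm := sub_conj_ne_zero m m
  have hwm : conj (w : ℂ) - m ≠ 0 := by rw [← neg_sub]; exact neg_ne_zero.mpr hmw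
  simp only [kernelValue, blaschke, blaschkeDefectCoeff, map_mul, map_div₀, map_sub, map_one,
    Complex.conj_conj, mul_comm (b m)]
  field_simp
  ring

lemma isGramSum_blaschke (hm : kernelValue b m m ≠ 0) :
    IsGramSum (fun z => conj (blaschke m z) • repKernel b z)
      (fun z => repKernel b z - (kernelValue b z m / kernelValue b m m) • repKernel b m)
      fun z => conj (blaschkeDefectCoeff b m z) • repKernel b m := fun z w => by
  simp only [inner_smul_left, inner_smul_right, inner_sub_left, inner_sub_right,
    inner_repKernel_repKernel, Complex.conj_conj, map_div₀, conj_kernelValue]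
  have h := blaschke_mul_kernelValue hm w z
  field_simp at h ⊢
  linear_combination h

lemma exists_blaschke_quotient (hm : repKernel b m ≠ 0) :
    ∃ D : DBR b →L[ℂ] DBR b, ∀ f, f m = 0 → ∀ z, blaschke m z * D f z = f z := by
  have hK : kernelValue b m m ≠ 0 := by
    rwa [← inner_repKernel_repKernel, inner_self_ne_zero]
  have hdense : Dense (Submodule.span ℂ
      (range fun z => conj (blaschke m z) • repKernel b z) : Set (DBR b)) := by
    refine dense_span_range_iff.mpr fun f hf => eq_zero_of_forall_notMem (finite_singleton m) ?_
    intro z hz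
    simpa [inner_smul_left, inner_repKernel, blaschke_ne_zero hz] using hf z
  obtain ⟨D, hD⟩ := (isGramSum_blaschke hK).exists_clm_inner_eq hdense
  refine ⟨D, fun f hf z => ?_⟩
  simpa [inner_smul_left, inner_sub_left, inner_repKernel, hf, mul_comm] using hD f z

lemma eq_zero_of_blaschke_mul_eq {f : DBR b} {c : ℂ} (hf : ∀ z, blaschke m z * (c * f z) = f z) :
    f = 0 := by
  have hfin : {z | blaschke m z * c = 1}.Finite := by
    refine Subsingleton.finite fun z hz w hw => blaschke_injective m ?_
    have hc : c ≠ 0 := right_ne_zero_of_mul (hz.trans_ne one_ne_zero)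
    exact mul_right_cancel₀ hc (hz.trans hw.symm)
  refine eq_zero_of_forall_notMem hfin fun z hz => ?_
  have h : (blaschke m z * c - 1) * f z = 0 := by linear_combination hf z
  exact (mul_eq_zero.mp h).resolve_left (sub_ne_zero.mpr hz)

lemma vanishingSubmodule_eq_bot_of_forall_apply_eq_zero {Λ : Set ℍ}
    (hm : repKernel b m ≠ 0) (hmΛ : m ∉ Λ) [FiniteDimensional ℂ (vanishingSubmodule b Λ)]
    (h : ∀ f ∈ vanishingSubmodule b Λ, f m = 0) : vanishingSubmodule b Λ = ⊥ := by
  obtain ⟨D, hD⟩ := exists_blaschke_quotient hm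
  have hinv : ∀ f ∈ vanishingSubmodule b Λ, D.toLinearMap f ∈ vanishingSubmodule b Λ := by
    intro f hf l hl
    have hlm : l ≠ m := ne_of_mem_of_not_mem hl hmΛ
    have hDl := hD f (h f hf) l
    rw [hf l hl] at hDl
    exact (mul_eq_zero.mp hDl).resolve_left (blaschke_ne_zero hlm)
  by_contra hbot
  have : Nontrivial (vanishingSubmodule b Λ) := Submodule.nontrivial_iff_ne_bot.mpr hbot
  obtain ⟨c, hc⟩ := Module.End.exists_eigenvalue (D.toLinearMap.restrict hinv)
  obtain ⟨f, hf⟩ := hc.exists_hasEigenvector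
  have hDf : D f = c • (f : DBR b) := congrArg Subtype.val hf.apply_eq_smul
  refine hf.2 (Subtype.ext (eq_zero_of_blaschke_mul_eq (m := m) (c := c) fun z => ?_))
  simpa [hDf] using hD f (h f f.2) z

lemma exists_isAOB_isCompleteSeq_tail {lam : ℕ → ℍ} (hk : ∀ n, repKernel b (lam n) ≠ 0)
    (hinj : Function.Injective lam) (huniq : vanishingSubmodule b (range lam) = ⊥)
    (hx : ∃ p, IsAOSFrom p fun n => normKernel b (lam n)) :
    ∃ p, IsAOB (fun n => normKernel b (lam (n + p))) ∧
      IsCompleteSeq fun n => normKernel b (lam (n + p)) := by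
  classical
  have hp := Nat.find_spec hx
  refine ⟨Nat.find hx, hp.isAOB_comp_add, ?_⟩
  rw [isCompleteSeq_normKernel_iff fun n => hk _]
  rcases hq : Nat.find hx with - | q
  · simpa using huniq
  have hsplit : vanishingSubmodule b (lam '' Ici (q + 1) ∪ lam '' Iio (q + 1)) = ⊥ := by
    rwa [← image_union, Ici_union_Iio, image_univ]
  have := finiteDimensional_vanishingSubmodule ((finite_Iio (q + 1)).image lam) hsplit
  rw [range_add_eq_image_Ici]
  refine vanishingSubmodule_eq_bot_of_forall_apply_eq_zero (m := lam q) (hk q)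
    (by simp [hinj.eq_iff]) fun f hf => ?_
  by_contra hfq
  have horth : ∀ n > q, ⟪f, normKernel b (lam n)⟫_ℂ = 0 := fun n hn =>
    inner_eq_zero_symm.mp <| (inner_normKernel_eq_zero_iff (hk n)).mpr (hf _ ⟨n, hn, rfl⟩)
  have hfq' : ⟪f, normKernel b (lam q)⟫_ℂ ≠ 0 := fun h0 =>
    hfq ((inner_normKernel_eq_zero_iff (hk q)).mp (inner_eq_zero_symm.mp h0))
  rw [hq] at hp
  exact Nat.find_min hx (by lia) (hp.of_succ horth hfq')

end Blaschke

section Comparison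

variable {b b₁ b₂ : HInfBall} {lam : ℕ → ℍ} {p : ℕ}

/-- The kernel `k_l^{b₁}` divided by the norm of `k_l^{b₂}`. -/
noncomputable def scaledKernel (b₁ b₂ : HInfBall) (l : ℍ) : DBR b₁ :=
  ((‖repKernel b₂ l‖⁻¹ : ℝ) : ℂ) • repKernel b₁ l

/-- The vector `conj (b₂ l) k_l^b / ‖k_l^{b₂}‖`: for `b₁ = b₂ b`, the Gram matrix of these vectors
is what that of `scaledKernel b₁ b₂` has in excess of that of `normKernel b₂`. -/
noncomputable def defectKernel (b₂ b : HInfBall) (l : ℍ) : DBR b :=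
  (((‖repKernel b₂ l‖⁻¹ : ℝ) : ℂ) * conj (b₂ l)) • repKernel b l

lemma isGramSum_scaledKernel (hdiv : ∀ z, b₁ z = b₂ z * b z) :
    IsGramSum (scaledKernel b₁ b₂) (normKernel b₂) (defectKernel b₂ b) := fun z l => by
  have h := isGramSum_repKernel hdiv z l
  simp only [inner_smul_left, inner_smul_right] at h
  simp only [scaledKernel, normKernel, defectKernel, inner_smul_left, inner_smul_right, h, map_mul]
  ring

lemma norm_scaledKernel_sq (b₁ b₂ : HInfBall) (l : ℍ) :
    ‖scaledKernel b₁ b₂ l‖ ^ 2 = kernelRatio b₁ b₂ l := by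
  simp [scaledKernel, kernelRatio, norm_smul, mul_pow, div_eq_inv_mul]

lemma norm_normKernel {l : ℍ} (hl : repKernel b l ≠ 0) : ‖normKernel b l‖ = 1 := by
  simp [normKernel, norm_smul, hl]

lemma norm_defectKernel_sq (hdiv : ∀ z, b₁ z = b₂ z * b z) {l : ℍ} (hl : repKernel b₂ l ≠ 0) :
    ‖defectKernel b₂ b l‖ ^ 2 = kernelRatio b₁ b₂ l - 1 := by
  have h := (isGramSum_scaledKernel hdiv).norm_sq_eq l
  rw [norm_scaledKernel_sq, norm_normKernel hl] at h
  linarith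

lemma repKernel_ne_zero_of_tendsto (h : Tendsto (fun n => kernelRatio b₁ b₂ (lam n)) atTop (𝓝 1))
    (z : ℍ) : repKernel b₁ z ≠ 0 ∧ repKernel b₂ z ≠ 0 := by
  refine not_or.mp fun h0 => zero_ne_one (tendsto_nhds_unique (tendsto_const_nhds.congr ?_) h)
  intro n
  rcases h0 with h0 | h0 <;> simp [kernelRatio, repKernel_eq_zero_of_eq_zero h0]

lemma tendsto_norm_scaledKernel (h : Tendsto (fun n => kernelRatio b₁ b₂ (lam n)) atTop (𝓝 1)) :
    Tendsto (fun n => ‖scaledKernel b₁ b₂ (lam n)‖) atTop (𝓝 1) := by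
  simpa [← norm_scaledKernel_sq] using h.sqrt

lemma isAOSFrom_scaledKernel_iff (h : Tendsto (fun n => kernelRatio b₁ b₂ (lam n)) atTop (𝓝 1)) :
    IsAOSFrom p (fun n => scaledKernel b₁ b₂ (lam n)) ↔
      IsAOSFrom p fun n => normKernel b₁ (lam n) := by
  set w : ℕ → ℂ := fun n => (‖scaledKernel b₁ b₂ (lam n)‖ : ℂ) with hw
  have hk := repKernel_ne_zero_of_tendsto h
  have hw0 (n : ℕ) : w n ≠ 0 := by simp [hw, scaledKernel, (hk _).1, (hk _).2]
  have hw1 : Tendsto (fun n => ‖w n‖) atTop (𝓝 1) := by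
    simpa [hw] using tendsto_norm_scaledKernel h
  have heq (n : ℕ) : w n • normKernel b₁ (lam n) = scaledKernel b₁ b₂ (lam n) := by
    have := norm_ne_zero_iff.mpr (hk (lam n)).1
    simp [hw, scaledKernel, normKernel, norm_smul, smul_smul, this]
  refine ⟨fun hx => ?_, fun hx => by simpa only [heq] using hx.smul hw0 hw1⟩
  have := hx.smul (w := fun n => (w n)⁻¹) (fun n => inv_ne_zero (hw0 n))
    (by simpa using hw1.inv₀ one_ne_zero)
  simpa only [← heq, inv_smul_smul₀ (hw0 _)] using this

lemma tendsto_kernelRatio (h : Summable fun n => |kernelRatio b₁ b₂ (lam n) - 1|) :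
    Tendsto (fun n => kernelRatio b₁ b₂ (lam n)) atTop (𝓝 1) :=
  tendsto_iff_norm_sub_tendsto_zero.mpr h.tendsto_atTop_zero

lemma summable_norm_defectKernel_sq (hdiv : ∀ z, b₁ z = b₂ z * b z)
    (h : Summable fun n => |kernelRatio b₁ b₂ (lam n) - 1|) :
    Summable fun n => ‖defectKernel b₂ b (lam n)‖ ^ 2 := by
  have hk := repKernel_ne_zero_of_tendsto (tendsto_kernelRatio h)
  simpa only [norm_defectKernel_sq hdiv (hk _).2] using h.of_abs

end Comparison

end HbSpace

open HbSpace in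
theorem theorem5p2 (b₁ b₂ b : HbSpace.HInfBall) (hdiv : ∀ z, b₁ z = b₂ z * b z)
    (lam : ℕ → UpperHalfPlane)
    (hsum : Summable fun n => |HbSpace.kernelRatio b₁ b₂ (lam n) - 1|) :
    (HbSpace.IsAOB (fun n => HbSpace.normKernel b₁ (lam n)) ∧
        HbSpace.IsCompleteSeq (fun n => HbSpace.normKernel b₁ (lam n)) →
      ∃ p : ℕ, HbSpace.IsAOB (fun n => HbSpace.normKernel b₂ (lam (n + p))) ∧
        HbSpace.IsCompleteSeq (fun n => HbSpace.normKernel b₂ (lam (n + p)))) ∧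
    (HbSpace.IsAOB (fun n => HbSpace.normKernel b₂ (lam n)) →
      HbSpace.IsAOB (fun n => HbSpace.normKernel b₁ (lam n))) := by
  have hratio := tendsto_kernelRatio hsum
  have hk := repKernel_ne_zero_of_tendsto hratio
  have hgram : IsGramSum (fun n => scaledKernel b₁ b₂ (lam n)) (fun n => normKernel b₂ (lam n))
      fun n => defectKernel b₂ b (lam n) := fun m n => isGramSum_scaledKernel hdiv (lam m) (lam n)
  have hdefect := summable_norm_defectKernel_sq hdiv hsum
  refine ⟨fun ⟨haob, hcomplete⟩ => ?_, fun haob => ?_⟩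
  · have hinj : Function.Injective lam :=
      Function.Injective.of_comp (f := normKernel b₁) haob.injective
    have huniq : vanishingSubmodule b₂ (Set.range lam) = ⊥ :=
      vanishingSubmodule_eq_bot_of_mul hdiv <|
        (isCompleteSeq_normKernel_iff fun n => (hk _).1).mp hcomplete
    exact exists_isAOB_isCompleteSeq_tail (fun n => (hk _).2) hinj huniq <|
      hgram.exists_isAOSFrom_left hdefect ((isAOSFrom_scaledKernel_iff hratio).mpr haob)
  · exact (isAOSFrom_scaledKernel_iff hratio).mp (hgram.isAOSFrom hdefect haob)
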